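/- For a squarefree integer $m\ge 1$ let $P(m)$ be the set of prime factors of $m$, and for $n\ge 1$ let $\Delta_n=\{P(m) : 1\le m\le n,\ m \text{ squarefree}\}$, an abstract simplicial complex (containing $\emptyset$). For a finite abstract simplicial complex $\Delta$ with $\emptyset\in\Delta$, an $i$-simplex is an element with $i+1$ vertices, $f_i^{\Delta}$ is the number of $i$-simplices ($i\ge -1$), $d=\dim\Delta$ is the largest $i$ with $f_i^\Delta\neq 0$, $\widetilde\chi(\Delta)=\sum_{\sigma\in\Delta}(-1)^{\#\sigma-1}$, and $h^{\Delta}(z)=\sum_{i=-1}^{d} f_i^{\Delta}(z-1)^{d-i}$. The barycentric subdivision $\Delta'$ is the complex whose vertices are the nonempty simplices of $\Delta$ and whose simplices are $\emptyset$ and the sets $\{\sigma_0\subsetneq\sigma_1\subsetneq\dots\subsetneq\sigma_m\}$ of nonempty simplices of $\Delta$; $\Delta^{(k)}$ is the $k$-times subdivided complex. Let $\rho_0^{(k)}\in\mathbb{C}$ denote a zero of minimal modulus of $h^{\Delta_n^{(k)}}$. For $i,d\ge 0$ let $f_{i,d}$ be the number of sets $\{\sigma_0\subsetneq\dots\subsetneq\sigma_i\}$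 of nonempty faces of a $d$-simplex $\sigma$ with $\sigma_i=\sigma$. Put $F_{d,d}=1$, $F_{-1,d}=0$ for $d\ge 0$, and for $0\le i<d$ $$F_{i,d}=\sum_{\ell\ge 0}\ \sum_{i=i_0<i_1<\dots<i_\ell<i_{\ell+1}=d}\ \prod_{s=0}^{\ell}\frac{f_{i_s,i_{s+1}}}{(d+1)!-(i_s+1)!}.$$ Let $H_d(z)=\sum_{i=-1}^{d}F_{i,d}(z-1)^{d-i}=\sum_{i=0}^{d+1}H_{i,d}z^{d+1-i}$; in particular $H_{1,d}$ is the coefficient of $z^{d}$. Let $n\ge 6$ and $d_n=\dim\Delta_n$. Then, with $n$ fixed, $$|\widetilde\chi(\Delta_n)|\ \sim\ H_{1,d_n}\, f^{\Delta_n}_{d_n}\,\bigl|\rho_0^{(k)}\bigr|\,(d_n+1)!^{\,k}\qquad (k\to\infty).$$ That is, if $\widetilde\chi(\Delta_n)\ne 0$ then the ratio of the left side to the right side tends to $1$ as $k\to\infty$; and if $\widetilde\chi(\Delta_n)=0$ (when the ratio is undefined) then the right side is $0$ for every $k\ge 0$. -/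

import Mathlib

namespace BarySub

open Polynomial

/-- A (finite) abstract simplicial complex: a finite family of finite sets of vertices that is
closed under taking subsets.  The empty set may be (and, unless the family is empty, is) a
simplex. -/
structure Complex (α : Type) where
  faces : Finset (Finset α)
  down_closed : ∀ σ ∈ faces, ∀ τ : Finset α, τ ⊆ σ → τ ∈ faces

namespace Complex

variable {α : Type}

/-- The dimension: the largest `d` such that some simplex has `d + 1` elements
(the complex whose only simplex is the empty set has dimension `-1`). -/
def dim (Δ : Complex α) : ℤ := (Δ.faces.sup Finset.card : ℕ) - 1

/-- The number of `i`-simplices, i.e. of simplices with `i + 1` elements, for `i ≥ -1`. -/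
def numFaces (Δ : Complex α) (i : ℤ) : ℕ :=
  (Δ.faces.filter fun σ => (σ.card : ℤ) = i + 1).card

/-- The Euler characteristic `∑ σ, (-1) ^ (#σ - 1)`, the sum running over all simplices
including the empty one (the exponent is written `#σ + 1`, which has the same parity). -/
def eulerChar (Δ : Complex α) : ℤ := ∑ σ ∈ Δ.faces, (-1) ^ (σ.card + 1)

/-- The `f`-polynomial `∑_{i=-1}^{d} f_i z^{d-i}`, where `d` is the dimension. -/
noncomputable def fPoly (Δ : Complex α) : ℤ[X] :=
  ∑ i ∈ Finset.Icc (-1) Δ.dim, C (Δ.numFaces i : ℤ) * X ^ (Δ.dim - i).toNat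

/-- The `h`-polynomial `h(z) = f(z - 1)`. -/
noncomputable def hPoly (Δ : Complex α) : ℤ[X] := Δ.fPoly.comp (X - 1)

open Classical in
/-- The barycentric subdivision.  Its vertices are the nonempty simplices of `Δ`, and its
simplices are the (possibly empty) finite sets `{σ₀ ⊊ σ₁ ⊊ ⋯ ⊊ σₘ}` of nonempty simplices of
`Δ`, that is, the sets of nonempty simplices that are totally ordered by inclusion. -/
noncomputable def subdivision (Δ : Complex α) : Complex (Finset α) where
  faces := (Δ.faces.erase ∅).powerset.filter
    fun s => IsChain (· ⊆ ·) (s : Set (Finset α))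
  down_closed := by
    intro σ hσ τ hτ
    simp only [Finset.mem_filter, Finset.mem_powerset] at hσ ⊢
    exact ⟨hτ.trans hσ.1, hσ.2.mono (Finset.coe_subset.2 hτ)⟩

end Complex

/-- The vertex type of the `k`-times subdivided complex. -/
def IterVertex (α : Type) : ℕ → Type
  | 0 => α
  | k + 1 => Finset (IterVertex α k)

/-- The `k`-times subdivided complex `Δ^(k)`. -/
noncomputable def Complex.iterSubdivision {α : Type} (Δ : Complex α) :
    (k : ℕ) → Complex (IterVertex α k)
  | 0 => Δ
  | k + 1 => (Complex.iterSubdivision Δ k).subdivision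

/-- The complex `Δ_n` of the sets `P(k)` of prime factors of the squarefree integers
`1 ≤ k ≤ n`. -/
def primeComplex (n : ℕ) : Complex ℕ where
  faces := ((Finset.Icc 1 n).filter Squarefree).image Nat.primeFactors
  down_closed := by
    intro σ hσ τ hτ
    simp only [Finset.mem_image, Finset.mem_filter, Finset.mem_Icc] at hσ ⊢
    obtain ⟨m, ⟨⟨h1, h2⟩, hm⟩, rfl⟩ := hσ
    have hp : ∀ p ∈ τ, p.Prime := fun p h => Nat.prime_of_mem_primeFactors (hτ h)
    have hdvd : ∏ p ∈ τ, p ∣ m :=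
      (Finset.prod_dvd_prod_of_subset _ _ _ hτ).trans (Nat.prod_primeFactors_dvd m)
    exact ⟨∏ p ∈ τ, p, ⟨⟨Nat.pos_of_dvd_of_pos hdvd h1, (Nat.le_of_dvd h1 hdvd).trans h2⟩,
      hm.squarefree_of_dvd hdvd⟩, Nat.primeFactors_prod hp⟩

open Classical in
/-- The numbers `f_{i,d}`, for `i, d ≥ 0`: the number of sets `{σ₀ ⊊ σ₁ ⊊ ⋯ ⊊ σᵢ}` of nonempty
simplices whose largest element `σᵢ` is a given `d`-simplex.  The `d`-simplex is taken to be
`Fin (d + 1)`. -/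
noncomputable def chainNum (i d : ℕ) : ℕ :=
  (Finset.univ.filter fun s : Finset (Finset (Fin (d + 1))) =>
    ∅ ∉ s ∧ IsChain (· ⊆ ·) (s : Set (Finset (Fin (d + 1)))) ∧ Finset.univ ∈ s ∧
      s.card = i + 1).card

open Classical in
/-- The rational numbers `F_{i,d}`, for `0 ≤ i ≤ d`: `F_{d,d} = 1`, and for `i < d` the sum, over
all `ℓ ≥ 0` and all `i = i₀ < i₁ < ⋯ < i_ℓ < i_{ℓ+1} = d`, of the product over `0 ≤ s ≤ ℓ` of
`f_{i_s, i_{s+1}} / ((d+1)! - (i_s + 1)!)`. -/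
noncomputable def FNum (i d : ℕ) : ℚ :=
  if i = d then 1 else
    ∑ l ∈ Finset.range d,
      ∑ c ∈ Finset.univ.filter (fun c : Fin (l + 2) → Fin (d + 1) =>
          StrictMono c ∧ (c 0 : ℕ) = i ∧ (c (Fin.last (l + 1)) : ℕ) = d),
        ∏ s : Fin (l + 1), (chainNum (c s.castSucc) (c s.succ) : ℚ) /
          (((d + 1).factorial : ℚ) - (((c s.castSucc : ℕ) + 1).factorial : ℚ))

/-- The `F`-polynomial `∑_{i=-1}^{d} F_{i,d} z^{d-i}`, `d ≥ 0`; since `F_{-1,d} = 0` by definition,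
the sum starts at `i = 0`. -/
noncomputable def FPoly (d : ℕ) : ℚ[X] :=
  ∑ i ∈ Finset.range (d + 1), C (FNum i d) * X ^ (d - i)

/-- The `H`-polynomial `H_d(z) = F_d(z - 1)`. -/
noncomputable def HPoly (d : ℕ) : ℚ[X] := (FPoly d).comp (X - 1)

/-- The numbers `H_{i,d}`, `0 ≤ i ≤ d + 1`, with `H_d(z) = ∑_{i=0}^{d+1} H_{i,d} z^{d+1-i}`. -/
noncomputable def HNum (i d : ℕ) : ℚ := (HPoly d).coeff (d + 1 - i)

/-- `z` is a complex zero of `p` whose modulus is minimal among all complex zeros of `p`. -/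
def IsMinModulusZero (p : ℤ[X]) (z : ℂ) : Prop :=
  aeval z p = 0 ∧ ∀ w : ℂ, aeval w p = 0 → ‖z‖ ≤ ‖w‖

end BarySub

namespace BarySub

open Polynomial

/-! Count simplices by their number of vertices and let N = d + 1 be the largest such number.
Subdivision acts linearly on these counts, since a chain of m nonempty sets with top σ amounts to a
surjection from σ onto m points (`card_topChains`, `faceCount_subdivision`). The matrix is
triangular with diagonal entries m!. For N ≥ 2 the entry N! strictly dominates, and the F_{i,d} form
its eigenvector (`sum_surjNum_mul_FNum`). Hence the counts divided by N!^k converge to the number of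
top simplices times this eigenvector (`tendsto_faceCount`).

The constant term of h is, up to sign, the Euler characteristic, which subdivision preserves. The
linear coefficient, divided by N!^k, converges to the number of top simplices times the coefficient
of z in H_d. That this equals the coefficient of z^d is a reciprocity: subdivision commutes with x ↦
-1 - x on generating polynomials (`subdivMap_comp_neg_one_sub_X`), and the eigenvalue N! is simple,
so the eigenvector is symmetric up to sign (`limitPoly_comp`).

If the Euler characteristic is nonzero, the logarithmic derivative of h at 0 bounds the smallest
zero by a constant over the linear coefficient (`norm_mul_norm_eval_derivative_le`), so ρ tends to
0. In h(ρ) = 0 the linear term then dominates the higher ones, and solving for the constant term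
gives the asymptotics. If the Euler characteristic is zero, 0 itself is a zero of h. -/

/-! ### Surjection numbers -/

/-- The number of surjections from an `n`-element set onto a `k`-element set. -/
def surjNum : ℕ → ℕ → ℕ
  | 0, 0 => 1
  | 0, _ + 1 => 0
  | _ + 1, 0 => 0
  | n + 1, k + 1 => (k + 1) * (surjNum n (k + 1) + surjNum n k)

theorem surjNum_succ_succ (n k : ℕ) :
    surjNum (n + 1) (k + 1) = (k + 1) * (surjNum n (k + 1) + surjNum n k) := rfl

@[simp] theorem surjNum_zero_zero : surjNum 0 0 = 1 := rfl
@[simp] theorem surjNum_zero_succ (k : ℕ) : surjNum 0 (k + 1) = 0 := rfl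
@[simp] theorem surjNum_succ_zero (n : ℕ) : surjNum (n + 1) 0 = 0 := rfl

theorem surjNum_eq_zero {n k : ℕ} (h : n < k) : surjNum n k = 0 := by
  induction n generalizing k with
  | zero => obtain ⟨k, rfl⟩ := Nat.exists_eq_succ_of_ne_zero h.ne'; rfl
  | succ n ih =>
    obtain ⟨k, rfl⟩ := Nat.exists_eq_succ_of_ne_zero (Nat.ne_zero_of_lt h)
    rw [Nat.succ_eq_add_one, surjNum_succ_succ, ih (by omega), ih (by omega), add_zero, mul_zero]

theorem surjNum_self (n : ℕ) : surjNum n n = n.factorial := by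
  induction n with
  | zero => rfl
  | succ n ih =>
    rw [surjNum_succ_succ, surjNum_eq_zero (Nat.lt_succ_self n), ih, Nat.factorial_succ, zero_add]

theorem surjNum_succ_one (n : ℕ) : surjNum (n + 1) 1 = 1 := by
  induction n with
  | zero => rfl
  | succ n ih => rw [surjNum_succ_succ, zero_add, ih, surjNum_succ_zero]

/-- A surjection from a subset onto k points extends to the whole set by sending the complement to
an extra point. The two terms on the right record whether that point is missed or hit. -/
theorem sum_choose_mul_surjNum (n k : ℕ) :
    ∑ m ∈ Finset.range (n + 1), n.choose m * surjNum m k = surjNum n k + surjNum n (k + 1) := by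
  induction n generalizing k with
  | zero => simp
  | succ n ih =>
    have key : ∑ m ∈ Finset.range (n + 2), (n + 1).choose m * surjNum m k =
        ∑ m ∈ Finset.range (n + 1), n.choose m * surjNum m k +
          ∑ m ∈ Finset.range (n + 1), n.choose m * surjNum (m + 1) k := by
      rw [Finset.sum_range_succ' _ (n + 1)]
      simp only [Nat.choose_succ_succ', add_mul, Finset.sum_add_distrib]
      have := Finset.sum_range_succ (fun m => n.choose m * surjNum m k) (n + 1)
      rw [Finset.sum_range_succ' _ (n + 1)] at this
      simp only [Nat.choose_succ_self, zero_mul, add_zero, Nat.choose_zero_right] at this ⊢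
      omega
    rw [key, ih]
    cases k with
    | zero => simp [surjNum_succ_succ]; ring
    | succ k =>
      have : ∑ m ∈ Finset.range (n + 1), n.choose m * surjNum (m + 1) (k + 1) =
          (k + 1) * (∑ m ∈ Finset.range (n + 1), n.choose m * surjNum m (k + 1) +
            ∑ m ∈ Finset.range (n + 1), n.choose m * surjNum m k) := by
        rw [← Finset.sum_add_distrib, Finset.mul_sum]
        refine Finset.sum_congr rfl fun m _ => ?_
        rw [surjNum_succ_succ]; ring
      rw [this, ih, ih, surjNum_succ_succ, surjNum_succ_succ]
      ring

/-! ### Chains of sets with a prescribed top -/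

section Chains

open Classical

variable {α : Type}

/-- The chains with `m` elements taken from a family of sets. -/
noncomputable def chainsIn (F : Finset (Finset α)) (m : ℕ) : Finset (Finset (Finset α)) :=
  F.powerset.filter fun s => IsChain (· ⊆ ·) (s : Set (Finset α)) ∧ s.card = m

/-- The chains of `m` nonempty sets with largest element `σ`. -/
noncomputable def topChains (σ : Finset α) (m : ℕ) : Finset (Finset (Finset α)) :=
  (chainsIn (σ.powerset.erase ∅) m).filter fun s => σ ∈ s

theorem sup_mem_of_isChain {s : Finset (Finset α)} (hs : IsChain (· ⊆ ·) (s : Set (Finset α)))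
    (hne : s.Nonempty) : s.sup id ∈ s := by
  obtain ⟨σ, hσ, hmax⟩ := s.exists_max_image Finset.card hne
  have : s.sup id = σ := by
    refine le_antisymm (Finset.sup_le fun τ hτ => ?_) (Finset.le_sup (f := id) hσ)
    rcases hs.total hτ hσ with h | h
    · exact h
    · exact (Finset.eq_of_subset_of_card_le h (hmax τ hτ)).ge
  rwa [this]

/-- Sort nonempty chains by their largest member; the closure hypothesis makes every chain of
nonempty subsets of that member admissible. -/
theorem card_chainsIn_eq_sum {F : Finset (Finset α)} (hF : ∅ ∉ F)
    (hdown : ∀ σ ∈ F, ∀ τ, τ ⊆ σ → τ ≠ ∅ → τ ∈ F) {m : ℕ} (hm : m ≠ 0) :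
    (chainsIn F m).card = ∑ σ ∈ F, (topChains σ m).card := by
  have hne : ∀ s ∈ chainsIn F m, s.Nonempty := by
    intro s hs
    simp only [chainsIn, Finset.mem_filter] at hs
    exact Finset.card_ne_zero.1 (by omega)
  have hmaps : ∀ s ∈ chainsIn F m, s.sup id ∈ F := by
    intro s hs
    have h := hne s hs
    simp only [chainsIn, Finset.mem_filter, Finset.mem_powerset] at hs
    exact hs.1 (sup_mem_of_isChain hs.2.1 h)
  rw [Finset.card_eq_sum_card_fiberwise hmaps]
  refine Finset.sum_congr rfl fun σ hσ => congrArg Finset.card ?_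
  ext s
  simp only [topChains, Finset.mem_filter]
  constructor
  · rintro ⟨hs, rfl⟩
    have h := hne s hs
    simp only [chainsIn, Finset.mem_filter, Finset.mem_powerset] at hs ⊢
    refine ⟨⟨fun τ hτ => ?_, hs.2⟩, sup_mem_of_isChain hs.2.1 h⟩
    rw [Finset.mem_erase, Finset.mem_powerset]
    exact ⟨fun h0 => hF (h0 ▸ hs.1 hτ), Finset.le_sup (f := id) hτ⟩
  · rintro ⟨hs, hσs⟩
    simp only [chainsIn, Finset.mem_filter, Finset.mem_powerset] at hs ⊢
    refine ⟨⟨fun τ hτ => ?_, hs.2⟩, ?_⟩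
    · have := hs.1 hτ
      rw [Finset.mem_erase, Finset.mem_powerset] at this
      exact hdown σ hσ τ this.2 this.1
    · refine le_antisymm (Finset.sup_le fun τ hτ => ?_) (Finset.le_sup (f := id) hσs)
      have := hs.1 hτ
      rw [Finset.mem_erase, Finset.mem_powerset] at this
      exact this.2

theorem card_topChains_succ {σ : Finset α} (hσ : σ ≠ ∅) (m : ℕ) :
    (topChains σ (m + 1)).card = (chainsIn (σ.ssubsets.erase ∅) m).card := by
  refine Finset.card_nbij' (fun s => s.erase σ) (fun s => insert σ s) ?_ ?_ ?_ ?_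
  · intro s hs
    simp only [topChains, chainsIn, Finset.coe_filter, Finset.mem_powerset, Set.mem_ofPred_eq,
      Finset.mem_filter] at hs ⊢
    obtain ⟨⟨h1, h2, h3⟩, h4⟩ := hs
    refine ⟨fun τ hτ => ?_, h2.mono (by simp), by rw [Finset.card_erase_of_mem h4, h3]; rfl⟩
    rw [Finset.mem_erase] at hτ
    have := h1 hτ.2
    rw [Finset.mem_erase, Finset.mem_powerset] at this
    rw [Finset.mem_erase, Finset.mem_ssubsets]
    exact ⟨this.1, this.2.ssubset_of_ne hτ.1⟩
  · intro s hs
    simp only [topChains, chainsIn, Finset.coe_filter, Finset.mem_powerset, Set.mem_ofPred_eq,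
      Finset.mem_filter] at hs ⊢
    obtain ⟨h1, h2, h3⟩ := hs
    have hsub : ∀ τ ∈ s, τ ≠ ∅ ∧ τ ⊂ σ := fun τ hτ => by
      have := h1 hτ
      rwa [Finset.mem_erase, Finset.mem_ssubsets] at this
    have hnot : σ ∉ s := fun h => (hsub σ h).2.ne rfl
    refine ⟨⟨fun τ hτ => ?_, ?_, by rw [Finset.card_insert_of_notMem hnot, h3]⟩,
      Finset.mem_insert_self _ _⟩
    · rw [Finset.mem_erase, Finset.mem_powerset]
      rcases Finset.mem_insert.1 hτ with rfl | h
      · exact ⟨hσ, subset_rfl⟩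
      · exact ⟨(hsub τ h).1, (hsub τ h).2.subset⟩
    · rw [Finset.coe_insert]
      exact h2.insert fun τ hτ _ => Or.inr (hsub τ hτ).2.subset
  · intro s hs
    simp only [topChains, Finset.coe_filter, Set.mem_ofPred_eq] at hs
    exact Finset.insert_erase hs.2
  · intro s hs
    simp only [chainsIn, Finset.coe_filter, Finset.mem_powerset, Set.mem_ofPred_eq] at hs
    refine Finset.erase_insert fun h => ?_
    have := hs.1 h
    rw [Finset.mem_erase, Finset.mem_ssubsets] at this
    exact this.2.ne rfl

theorem card_chainsIn_zero (F : Finset (Finset α)) : (chainsIn F 0).card = 1 := by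
  rw [Finset.card_eq_one]
  refine ⟨∅, ?_⟩
  ext s
  simp only [chainsIn, Finset.mem_filter, Finset.mem_powerset, Finset.card_eq_zero,
    Finset.mem_singleton]
  constructor
  · exact fun h => h.2.2
  · rintro rfl
    simp

/-- The successive differences of the chain partition σ into m ordered nonempty blocks. The formal
argument deletes the top and sorts the rest by its new top; `sum_choose_mul_surjNum`, without its
term for σ itself, closes the induction. -/
theorem card_topChains {σ : Finset α} (hσ : σ ≠ ∅) (m : ℕ) :
    (topChains σ m).card = surjNum σ.card m := by
  induction σ using Finset.strongInduction generalizing m with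
  | H σ ih =>
    obtain ⟨c, hc⟩ := Nat.exists_eq_succ_of_ne_zero (Finset.card_ne_zero.2
      (Finset.nonempty_iff_ne_empty.2 hσ))
    rcases m with _ | _ | m
    · rw [hc, surjNum_succ_zero, Finset.card_eq_zero, Finset.eq_empty_iff_forall_notMem]
      intro s hs
      simp only [topChains, chainsIn, Finset.mem_filter, Finset.card_eq_zero] at hs
      rw [hs.1.2.2] at hs
      simp at hs
    · rw [card_topChains_succ hσ, card_chainsIn_zero, hc, zero_add, surjNum_succ_one]
    · rw [card_topChains_succ hσ, card_chainsIn_eq_sum (by simp) _ m.succ_ne_zero]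
      · have h1 : ∑ τ ∈ σ.ssubsets.erase ∅, (topChains τ (m + 1)).card =
            ∑ τ ∈ σ.ssubsets, surjNum τ.card (m + 1) := by
          rw [← Finset.sum_erase (a := ∅) σ.ssubsets (by simp)]
          refine Finset.sum_congr rfl fun τ hτ => ?_
          rw [Finset.mem_erase, Finset.mem_ssubsets] at hτ
          exact ih τ hτ.2 hτ.1 _
        have h2 := Finset.sum_powerset_apply_card (fun j => surjNum j (m + 1)) (x := σ)
        have h3 := Finset.sum_erase_add σ.powerset (fun τ => surjNum τ.card (m + 1))
          (Finset.mem_powerset_self σ)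
        simp only [smul_eq_mul] at h2
        rw [sum_choose_mul_surjNum] at h2
        rw [h1, Finset.ssubsets]
        omega
      · intro τ hτ υ hυ hne
        rw [Finset.mem_erase, Finset.mem_ssubsets] at hτ ⊢
        exact ⟨hne, hυ.trans_ssubset hτ.2⟩

theorem chainNum_eq_surjNum (i d : ℕ) : chainNum i d = surjNum (d + 1) (i + 1) := by
  have h := card_topChains (σ := (Finset.univ : Finset (Fin (d + 1))))
    (Finset.univ_nonempty.ne_empty) (i + 1)
  rw [Finset.card_univ, Fintype.card_fin] at h
  rw [← h, chainNum]
  congr 1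
  ext s
  simp only [topChains, chainsIn, Finset.mem_filter, Finset.mem_powerset, Finset.mem_univ,
    true_and, Finset.powerset_univ, Finset.subset_erase, Finset.subset_univ]
  tauto

end Chains

/-! ### Face numbers under subdivision -/

namespace Complex

variable {α : Type} (Δ : Complex α)

/-- The number of simplices with `m` vertices. -/
def faceCount (m : ℕ) : ℕ := (Δ.faces.filter fun σ => σ.card = m).card

/-- The largest number of vertices of a simplex. -/
def maxCard : ℕ := Δ.faces.sup Finset.card

theorem sum_faces_eq {M : Type*} [AddCommMonoid M] (g : ℕ → M) {N : ℕ} (hN : Δ.maxCard ≤ N) :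
    ∑ σ ∈ Δ.faces, g σ.card = ∑ n ∈ Finset.range (N + 1), Δ.faceCount n • g n := by
  rw [← Finset.sum_fiberwise_of_maps_to (t := Finset.range (N + 1)) (g := Finset.card)
    fun σ hσ => Finset.mem_range_succ_iff.2 ((Finset.le_sup hσ).trans hN)]
  refine Finset.sum_congr rfl fun n _ => ?_
  rw [faceCount, ← Finset.sum_const]
  exact Finset.sum_congr rfl fun σ hσ => by rw [(Finset.mem_filter.1 hσ).2]

theorem faceCount_eq_zero {m : ℕ} (h : Δ.maxCard < m) : Δ.faceCount m = 0 := by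
  rw [faceCount, Finset.card_eq_zero, Finset.filter_eq_empty_iff]
  intro σ hσ hc
  have : σ.card ≤ Δ.maxCard := Finset.le_sup hσ
  omega

theorem faceCount_maxCard_pos (h : ∅ ∈ Δ.faces) : 0 < Δ.faceCount Δ.maxCard := by
  obtain ⟨σ, hσ, hc⟩ := Finset.exists_mem_eq_sup Δ.faces ⟨∅, h⟩ Finset.card
  exact Finset.card_pos.2 ⟨σ, Finset.mem_filter.2 ⟨hσ, hc.symm⟩⟩

theorem maxCard_eq {N : ℕ} (h0 : Δ.faceCount N ≠ 0) (h1 : ∀ m, N < m → Δ.faceCount m = 0) :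
    Δ.maxCard = N := by
  refine le_antisymm (Finset.sup_le fun σ hσ => ?_) ?_
  · by_contra! hlt
    have := h1 _ hlt
    rw [faceCount, Finset.card_eq_zero, Finset.filter_eq_empty_iff] at this
    exact this hσ rfl
  · by_contra! hlt
    exact h0 (Δ.faceCount_eq_zero hlt)

theorem faceCount_zero (h : ∅ ∈ Δ.faces) : Δ.faceCount 0 = 1 := by
  rw [faceCount, Finset.card_eq_one]
  refine ⟨∅, ?_⟩
  ext σ
  simp only [Finset.mem_filter, Finset.card_eq_zero, Finset.mem_singleton]
  exact ⟨fun h => h.2, fun hσ => ⟨hσ ▸ h, hσ⟩⟩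

theorem empty_mem_subdivision : ∅ ∈ Δ.subdivision.faces := by
  simp [subdivision]

theorem faceCount_subdivision (h : ∅ ∈ Δ.faces) {N : ℕ} (hN : Δ.maxCard ≤ N) (m : ℕ) :
    Δ.subdivision.faceCount m =
      ∑ n ∈ Finset.range (N + 1), surjNum n m * Δ.faceCount n := by
  classical
  cases m with
  | zero =>
    rw [faceCount_zero _ Δ.empty_mem_subdivision, Finset.sum_range_succ',
      Finset.sum_eq_zero fun n _ => by simp, Δ.faceCount_zero h]
    simp
  | succ m =>
    have h1 : Δ.subdivision.faceCount (m + 1) = (chainsIn (Δ.faces.erase ∅) (m + 1)).card := by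
      rw [faceCount, subdivision, chainsIn, Finset.filter_filter]
    rw [h1, card_chainsIn_eq_sum (by simp) _ m.succ_ne_zero]
    · have h2 : ∑ σ ∈ Δ.faces.erase ∅, (topChains σ (m + 1)).card =
          ∑ σ ∈ Δ.faces, surjNum σ.card (m + 1) := by
        rw [← Finset.sum_erase (a := ∅) Δ.faces (by simp)]
        exact Finset.sum_congr rfl fun σ hσ => card_topChains (Finset.ne_of_mem_erase hσ) _
      rw [h2, Δ.sum_faces_eq (fun n => surjNum n (m + 1)) hN]
      exact Finset.sum_congr rfl fun n _ => by rw [smul_eq_mul, mul_comm]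
    · intro σ hσ τ hτ hne
      rw [Finset.mem_erase] at hσ ⊢
      exact ⟨hne, Δ.down_closed σ hσ.2 τ hτ⟩

theorem faceCount_maxCard_subdivision (h : ∅ ∈ Δ.faces) :
    Δ.subdivision.faceCount Δ.maxCard = Δ.maxCard.factorial * Δ.faceCount Δ.maxCard := by
  rw [Δ.faceCount_subdivision h le_rfl, Finset.sum_range_succ, Finset.sum_eq_zero, zero_add,
    surjNum_self]
  intro n hn
  rw [surjNum_eq_zero (Finset.mem_range.1 hn), zero_mul]

theorem maxCard_subdivision (h : ∅ ∈ Δ.faces) : Δ.subdivision.maxCard = Δ.maxCard := by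
  refine maxCard_eq _ ?_ fun m hm => ?_
  · rw [Δ.faceCount_maxCard_subdivision h]
    exact mul_ne_zero (Nat.factorial_ne_zero _) (Δ.faceCount_maxCard_pos h).ne'
  · rw [Δ.faceCount_subdivision h le_rfl]
    refine Finset.sum_eq_zero fun n hn => ?_
    rw [surjNum_eq_zero ((Finset.mem_range_succ_iff.1 hn).trans_lt hm), zero_mul]

theorem empty_mem_iterSubdivision (h : ∅ ∈ Δ.faces) :
    ∀ k, (∅ : Finset (IterVertex α k)) ∈ (Δ.iterSubdivision k).faces
  | 0 => h
  | k + 1 => (Δ.iterSubdivision k).empty_mem_subdivision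

theorem maxCard_iterSubdivision (h : ∅ ∈ Δ.faces) (k : ℕ) :
    (Δ.iterSubdivision k).maxCard = Δ.maxCard := by
  induction k with
  | zero => rfl
  | succ k ih =>
    exact ((Δ.iterSubdivision k).maxCard_subdivision (Δ.empty_mem_iterSubdivision h k)).trans ih

theorem faceCount_iterSubdivision_succ (h : ∅ ∈ Δ.faces) (k m : ℕ) :
    (Δ.iterSubdivision (k + 1)).faceCount m =
      ∑ n ∈ Finset.range (Δ.maxCard + 1), surjNum n m * (Δ.iterSubdivision k).faceCount n :=
  (Δ.iterSubdivision k).faceCount_subdivision (Δ.empty_mem_iterSubdivision h k)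
    (Δ.maxCard_iterSubdivision h k).le m

theorem dim_eq : Δ.dim = (Δ.maxCard : ℤ) - 1 := rfl

theorem numFaces_natCast_sub_one (m : ℕ) : Δ.numFaces ((m : ℤ) - 1) = Δ.faceCount m := by
  simp [numFaces, faceCount]

theorem hPoly_eq : Δ.hPoly = ∑ m ∈ Finset.range (Δ.maxCard + 1),
    C (Δ.faceCount m : ℤ) * (X - 1) ^ (Δ.maxCard - m) := by
  have h : Δ.fPoly = ∑ m ∈ Finset.range (Δ.maxCard + 1),
      C (Δ.faceCount m : ℤ) * X ^ (Δ.maxCard - m) := by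
    rw [fPoly, dim_eq]
    symm
    refine Finset.sum_nbij' (fun m : ℕ => (m : ℤ) - 1) (fun i => (i + 1).toNat) ?_ ?_ ?_ ?_ ?_
    · intro m hm
      simp only [Finset.mem_range, Finset.mem_Icc] at hm ⊢
      omega
    · intro i hi
      simp only [Finset.mem_range, Finset.mem_Icc] at hi ⊢
      omega
    · intro m _; simp
    · intro i hi
      simp only [Finset.mem_Icc] at hi
      omega
    · intro m hm
      rw [numFaces_natCast_sub_one]
      congr 2
      omega
  simp [hPoly, h, sum_comp]

theorem eulerChar_eq {N : ℕ} (hN : Δ.maxCard ≤ N) : Δ.eulerChar =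
    ∑ m ∈ Finset.range (N + 1), (-1) ^ (m + 1) * (Δ.faceCount m : ℤ) := by
  rw [eulerChar, Δ.sum_faces_eq (fun n => (-1 : ℤ) ^ (n + 1)) hN]
  exact Finset.sum_congr rfl fun n _ => by rw [nsmul_eq_mul, mul_comm]

end Complex

/-! ### The eigenvector F_{i,d} -/

/-- The weight of a step `i < j` in the expansion of `F_{i,d}`. -/
noncomputable def stepWeight (d i j : ℕ) : ℚ :=
  (chainNum i j : ℚ) / (((d + 1).factorial : ℚ) - ((i + 1).factorial : ℚ))

open Classical in
/-- The weighted number of increasing sequences of `L` steps from `i` to `d`. -/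
noncomputable def pathSum (d L i : ℕ) : ℚ :=
  ∑ c ∈ Finset.univ.filter (fun c : Fin (L + 1) → Fin (d + 1) =>
      StrictMono c ∧ (c 0 : ℕ) = i ∧ (c (Fin.last L) : ℕ) = d),
    ∏ s : Fin L, stepWeight d (c s.castSucc) (c s.succ)

theorem pathSum_zero (d i : ℕ) : pathSum d 0 i = if i = d then 1 else 0 := by
  classical
  rw [pathSum]
  simp only [Finset.univ_eq_empty, Finset.prod_empty, Finset.sum_const, nsmul_eq_mul, mul_one]
  split_ifs with h
  · subst h
    rw [Nat.cast_eq_one, Finset.card_eq_one]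
    refine ⟨fun _ => Fin.last i, ?_⟩
    ext c
    simp only [Finset.mem_filter, Finset.mem_univ, true_and, Finset.mem_singleton]
    constructor
    · rintro ⟨-, h, -⟩
      funext s
      rw [Fin.eq_zero s]
      exact Fin.ext h
    · rintro rfl
      exact ⟨fun a b h => absurd h (by rw [Fin.eq_zero a, Fin.eq_zero b]; exact lt_irrefl _), rfl, rfl⟩
  · rw [Nat.cast_eq_zero, Finset.card_eq_zero, Finset.filter_eq_empty_iff]
    rintro c - ⟨-, h1, h2⟩
    exact h (h1.symm.trans h2)

theorem strictMono_cons_iff {n m : ℕ} {a : Fin m} {c : Fin (n + 1) → Fin m} :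
    StrictMono (Fin.cons a c : Fin (n + 2) → Fin m) ↔ a < c 0 ∧ StrictMono c := by
  rw [Fin.strictMono_cons]
  exact ⟨fun h => ⟨h.1 0, h.2⟩,
    fun h => ⟨fun j => h.1.trans_le (h.2.monotone (Fin.zero_le j)), h.2⟩⟩

theorem consEquiv_eq_cons {n m : ℕ} (a : Fin m) (c : Fin n → Fin m) :
    (Fin.consEquiv fun _ => Fin m) (a, c) = (Fin.cons a c : Fin (n + 1) → Fin m) := rfl

/-- Split off the first step and sum over its endpoint j. -/
theorem pathSum_succ (d L : ℕ) (i : Fin (d + 1)) :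
    pathSum d (L + 1) i =
      ∑ j : Fin (d + 1), if i < j then stepWeight d i j * pathSum d L j else 0 := by
  classical
  have hl : pathSum d (L + 1) i = ∑ c : Fin (L + 1) → Fin (d + 1),
      if StrictMono c ∧ i < c 0 ∧ (c (Fin.last L) : ℕ) = d then
        stepWeight d i (c 0) * ∏ s : Fin L, stepWeight d (c s.castSucc) (c s.succ) else 0 := by
    rw [pathSum, Finset.sum_filter, ← (Fin.consEquiv fun _ => Fin (d + 1)).sum_comp,
      Fintype.sum_prod_type, Finset.sum_eq_single i]
    · refine Finset.sum_congr rfl fun c _ => ?_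
      simp only [consEquiv_eq_cons, Fin.prod_univ_succ, strictMono_cons_iff, Fin.cons_zero,
        Fin.castSucc_zero, Fin.cons_succ, ← Fin.succ_castSucc, ← Fin.succ_last]
      refine if_congr (by tauto) rfl rfl
    · intro a _ ha
      refine Finset.sum_eq_zero fun c _ => if_neg ?_
      rintro ⟨-, h, -⟩
      exact ha (Fin.ext h)
    · simp
  rw [hl]
  simp only [pathSum, Finset.sum_filter, Finset.mul_sum, mul_ite, mul_zero]
  have : ∀ j : Fin (d + 1), (if i < j then ∑ c : Fin (L + 1) → Fin (d + 1),
      (if StrictMono c ∧ (c 0 : ℕ) = j ∧ (c (Fin.last L) : ℕ) = d then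
        stepWeight d i j * ∏ s : Fin L, stepWeight d (c s.castSucc) (c s.succ) else 0) else 0) =
      ∑ c : Fin (L + 1) → Fin (d + 1), if j = c 0 then
        (if StrictMono c ∧ i < c 0 ∧ (c (Fin.last L) : ℕ) = d then
        stepWeight d i (c 0) * ∏ s : Fin L, stepWeight d (c s.castSucc) (c s.succ) else 0)
        else 0 := by
    intro j
    by_cases hij : i < j
    · rw [if_pos hij]
      refine Finset.sum_congr rfl fun c _ => ?_
      by_cases hj : j = c 0
      · subst hj; simp [hij]
      · rw [if_neg hj, if_neg]
        rintro ⟨-, h, -⟩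
        exact hj (Fin.ext h.symm)
    · rw [if_neg hij]
      symm
      refine Finset.sum_eq_zero fun c _ => ?_
      by_cases hj : j = c 0
      · subst hj; simp [hij]
      · rw [if_neg hj]
  rw [Finset.sum_congr rfl fun j _ => this j, Finset.sum_comm]
  simp

theorem pathSum_eq_zero {d L : ℕ} {i : Fin (d + 1)} (h : d < L + i) : pathSum d L i = 0 := by
  induction L generalizing i with
  | zero => exact absurd i.2 (by omega)
  | succ L ih =>
    rw [pathSum_succ]
    refine Finset.sum_eq_zero fun j _ => ?_
    split_ifs with hij
    · rw [ih (by have : (i : ℕ) < j := hij; omega), mul_zero]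
    · rfl

theorem FNum_self (d : ℕ) : FNum d d = 1 := if_pos rfl

theorem FNum_of_ne {i d : ℕ} (h : i ≠ d) :
    FNum i d = ∑ L ∈ Finset.range d, pathSum d (L + 1) i := if_neg h

theorem FNum_eq_sum_pathSum {d : ℕ} (i : Fin (d + 1)) :
    FNum i d = ∑ L ∈ Finset.range (d + 1), pathSum d L i := by
  rw [Finset.sum_range_succ', pathSum_zero]
  by_cases h : (i : ℕ) = d
  · rw [if_pos h, Finset.sum_eq_zero fun L _ => pathSum_eq_zero (by omega), zero_add]
    rw [h, FNum_self]
  · rw [if_neg h, add_zero, FNum_of_ne h]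

/-- This is the eigenvector equation solved for its i-th entry: the denominator (d+1)! - (i+1)! in
the step weight is the difference of two diagonal entries. -/
theorem FNum_eq_sum {d : ℕ} {i : Fin (d + 1)} (h : (i : ℕ) ≠ d) :
    FNum i d = ∑ j : Fin (d + 1), if i < j then stepWeight d i j * FNum j d else 0 := by
  rw [FNum_of_ne h, Finset.sum_congr rfl fun L _ => pathSum_succ d L i, Finset.sum_comm]
  refine Finset.sum_congr rfl fun j _ => ?_
  split_ifs with hij
  -- The two ranges differ by the length L = d, which no path starting at j > i ≥ 0 can attain.
  · rw [← Finset.mul_sum, FNum_eq_sum_pathSum, Finset.sum_range_succ, pathSum_eq_zero, add_zero]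
    have : (i : ℕ) < j := hij
    omega
  · simp

theorem stepWeight_nonneg {d i : ℕ} (h : i ≤ d) (j : ℕ) : 0 ≤ stepWeight d i j := by
  have : ((i + 1).factorial : ℚ) ≤ (d + 1).factorial := by
    exact_mod_cast Nat.factorial_le (by omega)
  exact div_nonneg (Nat.cast_nonneg _) (sub_nonneg.2 this)

theorem FNum_nonneg {d : ℕ} (i : Fin (d + 1)) : 0 ≤ FNum i d := by
  rw [FNum_eq_sum_pathSum]
  refine Finset.sum_nonneg fun L _ => Finset.sum_nonneg fun c _ => Finset.prod_nonneg fun s _ =>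
    stepWeight_nonneg (by omega) _

theorem factorial_lt_factorial_cast {i d : ℕ} (hi : 1 ≤ i) (h : i < d) :
    (i.factorial : ℚ) < d.factorial := by
  exact_mod_cast (Nat.factorial_lt hi).2 h

/-- For d > 0 the single step from 0 to d already contributes a positive term. Positivity makes the
limiting linear coefficient nonzero. -/
theorem FNum_zero_pos (d : ℕ) : 0 < FNum 0 d := by
  rcases Nat.eq_zero_or_pos d with rfl | hd
  · rw [FNum_self]; exact one_pos
  have h0 : ((0 : Fin (d + 1)) : ℕ) ≠ d := by simpa using hd.ne
  have h := FNum_eq_sum h0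
  rw [Fin.val_zero] at h
  rw [h]
  refine Finset.sum_pos' (fun j _ => ?_) ⟨Fin.last d, Finset.mem_univ _, ?_⟩
  · split_ifs
    · exact mul_nonneg (stepWeight_nonneg (Nat.zero_le _) _) (FNum_nonneg j)
    · exact le_rfl
  · rw [if_pos (Fin.pos_iff_ne_zero.2 fun h => h0 (by rw [← h]; rfl)), Fin.val_last, FNum_self,
      mul_one, stepWeight, chainNum_eq_surjNum, surjNum_succ_one]
    exact div_pos (by simp) (sub_pos.2 (factorial_lt_factorial_cast (by omega) (by omega)))

/-- The vector `(F_{i,d})` is an eigenvector, for the eigenvalue `(d+1)!`, of the transformation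
of face numbers under subdivision; faces are counted by their number of vertices. -/
theorem sum_surjNum_mul_FNum {d i : ℕ} (hi : i ≤ d) :
    ∑ j ∈ Finset.range (d + 1), (surjNum (j + 1) (i + 1) : ℚ) * FNum j d =
      (d + 1).factorial * FNum i d := by
  have hsplit : ∑ j ∈ Finset.range (d + 1), (surjNum (j + 1) (i + 1) : ℚ) * FNum j d =
      (i + 1).factorial * FNum i d + ∑ j ∈ Finset.range (d + 1),
        if i < j then (surjNum (j + 1) (i + 1) : ℚ) * FNum j d else 0 := by
    have h1 : ((i + 1).factorial : ℚ) * FNum i d = ∑ j ∈ Finset.range (d + 1),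
        if i = j then (surjNum (j + 1) (i + 1) : ℚ) * FNum j d else 0 := by
      rw [Finset.sum_ite_eq, if_pos (Finset.mem_range_succ_iff.2 hi), surjNum_self]
    rw [h1, ← Finset.sum_add_distrib]
    refine Finset.sum_congr rfl fun j _ => ?_
    rcases lt_trichotomy i j with h | h | h
    · rw [if_neg h.ne, if_pos h, zero_add]
    · rw [if_pos h, if_neg h.not_lt, add_zero]
    · rw [if_neg h.ne', if_neg h.not_gt, surjNum_eq_zero (by omega)]; simp
  rw [hsplit]
  rcases hi.eq_or_lt with rfl | hlt
  · rw [Finset.sum_eq_zero, add_zero]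
    intro j hj
    exact if_neg (by rw [Finset.mem_range] at hj; omega)
  · have h := FNum_eq_sum (d := d) (i := ⟨i, by omega⟩) hlt.ne
    simp only [Fin.lt_def] at h
    rw [Fin.sum_univ_eq_sum_range
      (fun j => if i < j then stepWeight d i j * FNum j d else 0) (d + 1)] at h
    have hne : ((d + 1).factorial : ℚ) - (i + 1).factorial ≠ 0 :=
      (sub_pos.2 (factorial_lt_factorial_cast (by omega) (by omega))).ne'
    have h2 : ∑ j ∈ Finset.range (d + 1),
        (if i < j then (surjNum (j + 1) (i + 1) : ℚ) * FNum j d else 0) =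
        (((d + 1).factorial : ℚ) - (i + 1).factorial) * FNum i d := by
      rw [h, Finset.mul_sum]
      refine Finset.sum_congr rfl fun j _ => ?_
      split_ifs
      · rw [stepWeight, chainNum_eq_surjNum]; field_simp
      · simp
    rw [h2]; ring

/-! ### Generating polynomials and the symmetry x ↦ -1 - x -/

/-- The generating polynomial of the surjection numbers. -/
noncomputable def surjPoly : ℕ → ℚ[X]
  | 0 => 1
  | n + 1 => X * derivative ((1 + X) * surjPoly n)

theorem surjPoly_succ (n : ℕ) :
    surjPoly (n + 1) = X * derivative ((1 + X) * surjPoly n) := rfl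

theorem coeff_surjPoly (n k : ℕ) : (surjPoly n).coeff k = surjNum n k := by
  induction n generalizing k with
  | zero =>
    cases k with
    | zero => simp [surjPoly]
    | succ k => simp [surjPoly, coeff_one]
  | succ n ih =>
    cases k with
    | zero => simp [surjPoly_succ]
    | succ k =>
      rw [surjPoly_succ, coeff_X_mul, coeff_derivative, add_mul, one_mul, coeff_add, coeff_X_mul,
        ih, ih, surjNum_succ_succ]
      push_cast; ring

/-- The linear map sending the generating polynomial of the face numbers of a complex to that of
its barycentric subdivision. -/
noncomputable def subdivMap : ℚ[X] →ₗ[ℚ] ℚ[X] :=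
  lsum fun n => LinearMap.toSpanSingleton ℚ ℚ[X] (surjPoly n)

theorem subdivMap_monomial (n : ℕ) (a : ℚ) : subdivMap (monomial n a) = a • surjPoly n := by
  rw [subdivMap, lsum_apply, sum_monomial_index] <;> simp

theorem subdivMap_X_pow (n : ℕ) : subdivMap (X ^ n) = surjPoly n := by
  rw [X_pow_eq_monomial, subdivMap_monomial, one_smul]

theorem subdivMap_X_mul (p : ℚ[X]) :
    subdivMap (X * p) = X * derivative ((1 + X) * subdivMap p) := by
  induction p using Polynomial.induction_on' with
  | add p q hp hq => rw [mul_add, map_add, hp, hq, map_add, mul_add, derivative_add, mul_add]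
  | monomial n a =>
    rw [X_mul_monomial, subdivMap_monomial, subdivMap_monomial, surjPoly_succ, mul_smul_comm,
      derivative_smul, mul_smul_comm]

theorem coeff_subdivMap {p : ℚ[X]} {N : ℕ} (hp : p.natDegree ≤ N) (m : ℕ) :
    (subdivMap p).coeff m = ∑ n ∈ Finset.range (N + 1), (surjNum n m : ℚ) * p.coeff n := by
  conv_lhs => rw [p.as_sum_range' (N + 1) (by omega)]
  rw [map_sum, finsetSum_coeff]
  refine Finset.sum_congr rfl fun n _ => ?_
  rw [subdivMap_monomial, coeff_smul, coeff_surjPoly, smul_eq_mul, mul_comm]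

/-- Induct on monomials with `subdivMap_X_mul`. If T is the substituted image of X^n, the inductive
step is the identity (1+X)(XT)' = X((1+X)T)' + T. -/
theorem subdivMap_comp_neg_one_sub_X (p : ℚ[X]) :
    subdivMap (p.comp (-1 - X)) = (subdivMap p).comp (-1 - X) := by
  induction p using Polynomial.induction_on' with
  | add p q hp hq => rw [add_comp, map_add, hp, hq, map_add, add_comp]
  | monomial n a =>
    rw [← C_mul_X_pow_eq_monomial, C_mul', smul_comp, map_smul, map_smul, smul_comp]
    congr 1
    induction n with
    | zero =>
      have h1 : subdivMap 1 = 1 := by simpa [surjPoly] using subdivMap_X_pow 0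
      simp [h1]
    | succ n ih =>
      have h : (X ^ (n + 1) : ℚ[X]).comp (-1 - X) =
          -(X ^ n : ℚ[X]).comp (-1 - X) - X * (X ^ n : ℚ[X]).comp (-1 - X) := by
        simp only [pow_succ, mul_comp, X_comp]; ring
      have hd : derivative ((surjPoly n).comp (-1 - X)) =
          -(derivative (surjPoly n)).comp (-1 - X) := by
        rw [derivative_comp]; simp
      rw [h, map_sub, map_neg, subdivMap_X_mul, ih, subdivMap_X_pow, subdivMap_X_pow,
        surjPoly_succ, derivative_mul, derivative_mul, hd]
      simp only [mul_comp, add_comp, X_comp, one_comp, derivative_add, derivative_one,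
        derivative_X, zero_add]
      ring

theorem factorial_lt_factorial {m N : ℕ} (hN : 2 ≤ N) (h : m < N) : m.factorial < N.factorial := by
  rcases Nat.eq_zero_or_pos m with rfl | hm
  · exact (Nat.factorial_zero.trans_lt (by omega : 1 < N)).trans_le (Nat.self_le_factorial N)
  · exact (Nat.factorial_lt hm).2 h

/-- The map multiplies a leading coefficient in degree m by m!, which differs from N! when m < N.
The bound N ≥ 2 excludes 0! = 1!. -/
theorem eq_zero_of_subdivMap_eq_smul {p : ℚ[X]} {N : ℕ} (hN : 2 ≤ N) (hp : p.degree < N)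
    (h : subdivMap p = (N.factorial : ℚ) • p) : p = 0 := by
  by_contra hne
  have hlt : p.natDegree < N := (natDegree_lt_iff_degree_lt hne).2 hp
  have h1 := congrArg (fun q => q.coeff p.natDegree) h
  simp only [coeff_subdivMap le_rfl, coeff_smul, smul_eq_mul] at h1
  rw [Finset.sum_range_succ, Finset.sum_eq_zero, zero_add, surjNum_self] at h1
  · have h2 := mul_right_cancel₀ (leadingCoeff_ne_zero.2 hne) h1
    exact (factorial_lt_factorial hN hlt).ne (by exact_mod_cast h2)
  · intro n hn
    rw [surjNum_eq_zero (Finset.mem_range.1 hn)]; simp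

/-- The generating polynomial of the numbers `F_{i,d}`, with exponents counting vertices. -/
noncomputable def limitPoly (d : ℕ) : ℚ[X] :=
  X * ∑ i ∈ Finset.range (d + 1), C (FNum i d) * X ^ i

theorem coeff_limitPoly_zero (d : ℕ) : (limitPoly d).coeff 0 = 0 := by simp [limitPoly]

theorem coeff_limitPoly_succ (d i : ℕ) :
    (limitPoly d).coeff (i + 1) = if i < d + 1 then FNum i d else 0 := by
  simp [limitPoly, coeff_X_mul, coeff_C_mul, coeff_X_pow]

theorem natDegree_limitPoly (d : ℕ) : (limitPoly d).natDegree = d + 1 := by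
  refine natDegree_eq_of_le_of_coeff_ne_zero ?_ ?_
  · rw [natDegree_le_iff_coeff_eq_zero]
    rintro (_ | m) hm
    · omega
    · rw [coeff_limitPoly_succ, if_neg (by omega)]
  · rw [coeff_limitPoly_succ, if_pos (by omega), FNum_self]
    exact one_ne_zero

theorem leadingCoeff_limitPoly (d : ℕ) : (limitPoly d).leadingCoeff = 1 := by
  rw [leadingCoeff, natDegree_limitPoly, coeff_limitPoly_succ, if_pos (by omega), FNum_self]

theorem sum_surjNum_mul_coeff_limitPoly {d m : ℕ} (hm : m ≤ d + 1) :
    ∑ n ∈ Finset.range (d + 2), (surjNum n m : ℚ) * (limitPoly d).coeff n =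
      (d + 1).factorial * (limitPoly d).coeff m := by
  rw [Finset.sum_range_succ', coeff_limitPoly_zero, mul_zero, add_zero]
  cases m with
  | zero => rw [coeff_limitPoly_zero, Finset.sum_eq_zero] <;> simp
  | succ i =>
    rw [coeff_limitPoly_succ, if_pos (by omega), ← sum_surjNum_mul_FNum (by omega)]
    refine Finset.sum_congr rfl fun j hj => ?_
    rw [coeff_limitPoly_succ, if_pos (Finset.mem_range.1 hj)]

theorem subdivMap_limitPoly (d : ℕ) :
    subdivMap (limitPoly d) = ((d + 1).factorial : ℚ) • limitPoly d := by
  ext m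
  rw [coeff_subdivMap (natDegree_limitPoly d).le, coeff_smul, smul_eq_mul]
  rcases le_or_gt m (d + 1) with hm | hm
  · exact sum_surjNum_mul_coeff_limitPoly hm
  · rw [coeff_eq_zero_of_natDegree_lt ((natDegree_limitPoly d).trans_lt hm), mul_zero]
    refine Finset.sum_eq_zero fun n hn => ?_
    rw [surjNum_eq_zero (by rw [Finset.mem_range] at hn; omega)]; simp

theorem natDegree_neg_one_sub_X : (-1 - X : ℚ[X]).natDegree = 1 := by
  rw [show (-1 - X : ℚ[X]) = C (-1) * X + C (-1) by simp; ring]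
  exact natDegree_linear (by norm_num)

theorem leadingCoeff_neg_one_sub_X : (-1 - X : ℚ[X]).leadingCoeff = -1 := by
  rw [show (-1 - X : ℚ[X]) = C (-1) * X + C (-1) by simp; ring]
  exact leadingCoeff_linear (by norm_num)

/-- Both sides are eigenvectors for (d+1)! with the same coefficient in degree d + 1, so their
difference is an eigenvector of smaller degree and vanishes. -/
theorem limitPoly_comp {d : ℕ} (hd : 1 ≤ d) :
    (limitPoly d).comp (-1 - X) = ((-1) ^ (d + 1) : ℚ) • limitPoly d := by
  rw [← sub_eq_zero]
  have hdeg : ((limitPoly d).comp (-1 - X)).natDegree = d + 1 := by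
    rw [natDegree_comp, natDegree_limitPoly, natDegree_neg_one_sub_X, mul_one]
  refine eq_zero_of_subdivMap_eq_smul (N := d + 1) (by omega) ?_ ?_
  · rw [degree_lt_iff_coeff_zero]
    intro m hm
    rw [coeff_sub, coeff_smul, smul_eq_mul]
    rcases hm.eq_or_lt with rfl | hlt
    · have h1 : ((limitPoly d).comp (-1 - X)).coeff (d + 1) = (-1) ^ (d + 1) := by
        have := leadingCoeff_comp (p := limitPoly d) (q := -1 - X)
          (by rw [natDegree_neg_one_sub_X]; exact one_ne_zero)
        rwa [leadingCoeff, hdeg, leadingCoeff_limitPoly, leadingCoeff_neg_one_sub_X, one_mul,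
          natDegree_limitPoly] at this
      rw [h1, coeff_limitPoly_succ, if_pos (by omega), FNum_self, mul_one, sub_self]
    · rw [coeff_eq_zero_of_natDegree_lt (hdeg.trans_lt hlt),
        coeff_eq_zero_of_natDegree_lt ((natDegree_limitPoly d).trans_lt hlt), mul_zero, sub_zero]
  · rw [map_sub, subdivMap_comp_neg_one_sub_X, map_smul, subdivMap_limitPoly, smul_comp, smul_sub,
      smul_comm]

theorem eval_limitPoly_neg_one {d : ℕ} (hd : 1 ≤ d) : (limitPoly d).eval (-1) = 0 := by
  have h := congrArg (eval 0) (limitPoly_comp hd)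
  rw [eval_comp, eval_smul, ← coeff_zero_eq_eval_zero (limitPoly d), coeff_limitPoly_zero] at h
  simpa using h

theorem eval_derivative_limitPoly_neg_one {d : ℕ} (hd : 1 ≤ d) :
    (derivative (limitPoly d)).eval (-1) = (-1) ^ d * FNum 0 d := by
  have h := congrArg (fun p => eval 0 (derivative p)) (limitPoly_comp hd)
  have h0 : eval 0 (derivative (limitPoly d)) = FNum 0 d := by
    rw [← coeff_zero_eq_eval_zero, coeff_derivative, coeff_limitPoly_succ, if_pos (by omega)]
    simp
  simp only [derivative_comp, derivative_smul, eval_smul, h0, eval_mul, eval_comp] at h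
  simp at h
  rw [pow_succ] at h
  linarith

theorem coeff_one_X_sub_one_pow {R : Type*} [CommRing R] (n : ℕ) :
    ((X - 1 : R[X]) ^ n).coeff 1 = -((-1) ^ n * n) := by
  have h : ((X - 1 : R[X]) ^ n).coeff 1 = (derivative ((X - 1 : R[X]) ^ n)).coeff 0 := by
    rw [coeff_derivative]; simp
  rw [h, derivative_pow, coeff_zero_eq_eval_zero]
  cases n with
  | zero => simp
  | succ n => simp [pow_succ]; ring

/-- Writing L for `limitPoly d`, the left side equals (-1)^d ((d+1) L(-1) + L'(-1)). The symmetry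
carries both values at -1 to values at 0. -/
theorem sum_coeff_limitPoly_mul {d : ℕ} (hd : 1 ≤ d) :
    ∑ m ∈ Finset.range (d + 2), (limitPoly d).coeff m * ((X - 1 : ℚ[X]) ^ (d + 1 - m)).coeff 1 =
      FNum 0 d := by
  have h1 := eval_limitPoly_neg_one hd
  have h2 := eval_derivative_limitPoly_neg_one hd
  rw [eval_eq_sum_range, natDegree_limitPoly] at h1
  rw [derivative_eval, sum_over_range' _ (by simp) (d + 2) (by rw [natDegree_limitPoly]; omega)]
    at h2
  have h3 : ∀ m ∈ Finset.range (d + 2),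
      (limitPoly d).coeff m * ((X - 1 : ℚ[X]) ^ (d + 1 - m)).coeff 1 =
      (-1) ^ d * ((d + 1) * ((limitPoly d).coeff m * (-1) ^ m)) +
      (-1) ^ d * ((limitPoly d).coeff m * m * (-1) ^ (m - 1)) := by
    intro m hm
    rw [Finset.mem_range] at hm
    obtain ⟨e, he⟩ := Nat.exists_eq_add_of_le (by omega : m ≤ d + 1)
    have hd' : (d : ℚ) + 1 = m + e := by exact_mod_cast he
    have hs : (-1 : ℚ) ^ d * (-1) ^ m = -(-1) ^ e := by
      have : (-1 : ℚ) ^ (d + 1) * (-1) ^ m = (-1) ^ e := by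
        rw [he, pow_add, mul_right_comm, ← pow_add, ← two_mul, pow_mul]; simp
      rw [pow_succ] at this
      linarith
    rw [coeff_one_X_sub_one_pow, show d + 1 - m = e by omega, hd']
    have hm1 : (m : ℚ) * (-1) ^ (m - 1) = -(m * (-1) ^ m) := by
      cases m with
      | zero => simp
      | succ m => simp [pow_succ]
    rw [mul_assoc ((limitPoly d).coeff m) (m : ℚ), hm1]
    linear_combination (-(e * (limitPoly d).coeff m)) * hs
  rw [Finset.sum_congr rfl h3, Finset.sum_add_distrib, ← Finset.mul_sum, ← Finset.mul_sum,
    ← Finset.mul_sum, h1, h2, mul_zero, mul_zero, zero_add, ← mul_assoc, ← pow_add, ← two_mul,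
    pow_mul]
  simp

/-- Only the term i = 0 reaches degree d. With `sum_coeff_limitPoly_mul` this identifies the
coefficients of z and z^d. -/
theorem HNum_one (d : ℕ) : HNum 1 d = FNum 0 d := by
  rw [HNum, HPoly, FPoly, sum_comp, Nat.add_sub_cancel, finsetSum_coeff,
    Finset.sum_eq_single 0]
  · rw [C_mul_comp, coeff_C_mul, pow_comp, X_comp, Nat.sub_zero]
    have : ((X - 1 : ℚ[X]) ^ d).coeff d = 1 := by
      have h := (monic_X_sub_C (1 : ℚ)).pow d
      rw [Monic, leadingCoeff, natDegree_pow, natDegree_X_sub_C, mul_one] at h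
      simpa using h
    rw [this, mul_one]
  · intro i hi hne
    rw [C_mul_comp, coeff_C_mul, pow_comp, X_comp, coeff_eq_zero_of_natDegree_lt, mul_zero]
    rw [natDegree_pow, ← C_1, natDegree_X_sub_C, mul_one]
    rw [Finset.mem_range] at hi
    omega
  · simp

/-! ### Two analytic tools and an alternating sum -/

open Filter Topology

theorem tendsto_of_affine_recursion {a s : ℕ → ℝ} {r l : ℝ} (hr0 : 0 ≤ r) (hr1 : r < 1)
    (ha : ∀ k, a (k + 1) = r * a k + s k) (hs : Tendsto s atTop (𝓝 ((1 - r) * l))) :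
    Tendsto a atTop (𝓝 l) := by
  rw [Metric.tendsto_atTop]
  intro ε hε
  -- With this tolerance, ε/2 is the fixed point of the error recursion x ↦ r x + (1 - r)(ε/2).
  obtain ⟨K, hK⟩ := Metric.tendsto_atTop.1 hs ((1 - r) * (ε / 2))
    (mul_pos (sub_pos.2 hr1) (half_pos hε))
  have hbound : ∀ j, |a (K + j) - l| ≤ r ^ j * |a K - l| + ε / 2 := by
    intro j
    induction j with
    | zero => simp; linarith
    | succ j ih =>
      have h1 := hK (K + j) (by omega)
      rw [Real.dist_eq] at h1
      have h2 : a (K + (j + 1)) - l = r * (a (K + j) - l) + (s (K + j) - (1 - r) * l) := by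
        rw [← add_assoc, ha]; ring
      calc |a (K + (j + 1)) - l| ≤ r * |a (K + j) - l| + |s (K + j) - (1 - r) * l| := by
            rw [h2, ← abs_of_nonneg hr0, ← abs_mul, abs_of_nonneg hr0]; exact abs_add_le _ _
        _ ≤ r * (r ^ j * |a K - l| + ε / 2) + (1 - r) * (ε / 2) := by gcongr
        _ = r ^ (j + 1) * |a K - l| + ε / 2 := by ring
  have hgeom : Tendsto (fun j => r ^ j * |a K - l|) atTop (𝓝 0) := by
    simpa using (tendsto_pow_atTop_nhds_zero_of_lt_one hr0 hr1).mul_const |a K - l|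
  obtain ⟨J, hJ⟩ := (hgeom.eventually_lt_const (half_pos hε)).exists_forall_of_atTop
  refine ⟨K + J, fun n hn => ?_⟩
  obtain ⟨j, rfl⟩ := Nat.exists_eq_add_of_le (by omega : K ≤ n)
  rw [Real.dist_eq]
  have := hJ j (by omega)
  linarith [hbound j]

/-- At 0 the logarithmic derivative is minus the sum of the reciprocals of the zeros, each of
modulus at most 1/‖z‖ when z ≠ 0. -/
theorem norm_mul_norm_eval_derivative_le {p : ℂ[X]} {z : ℂ} (hp : p.eval 0 ≠ 0)
    (hz : ∀ w, p.eval w = 0 → ‖z‖ ≤ ‖w‖) :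
    ‖z‖ * ‖p.derivative.eval 0‖ ≤ p.natDegree * ‖p.eval 0‖ := by
  rcases eq_or_ne z 0 with rfl | hz0
  · rw [norm_zero, zero_mul]; positivity
  have hzpos := norm_pos_iff.2 hz0
  have h := (IsAlgClosed.splits p).eval_derivative_div_eval_of_ne_zero hp
  have hle : ‖p.derivative.eval 0 / p.eval 0‖ ≤ p.natDegree * ‖z‖⁻¹ := by
    rw [h]
    refine (norm_multiset_sum_le _).trans ?_
    rw [Multiset.map_map]
    refine (Multiset.sum_le_card_nsmul _ ‖z‖⁻¹ fun x hx => ?_).trans ?_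
    · obtain ⟨w, hw, rfl⟩ := Multiset.mem_map.1 hx
      have := hz w (isRoot_of_mem_roots hw)
      simp only [Function.comp_apply, zero_sub, one_div, norm_inv, norm_neg]
      gcongr
    · rw [Multiset.card_map, nsmul_eq_mul]
      have := card_roots' p
      gcongr
  rw [norm_div, div_le_iff₀ (norm_pos_iff.2 hp)] at hle
  calc ‖z‖ * ‖p.derivative.eval 0‖ ≤ ‖z‖ * (p.natDegree * ‖z‖⁻¹ * ‖p.eval 0‖) := by gcongr
    _ = p.natDegree * ‖p.eval 0‖ := by field_simp

/-- Evaluate the surjection polynomial at -1: the factor 1 + X vanishes there, so each recursion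
step only changes the sign. This yields invariance of the Euler characteristic. -/
theorem sum_neg_one_pow_mul_surjNum {n N : ℕ} (h : n ≤ N) :
    ∑ m ∈ Finset.range (N + 1), (-1 : ℤ) ^ (m + 1) * surjNum n m = (-1) ^ (n + 1) := by
  have h1 : ∀ n, (surjPoly n).eval (-1) = (-1) ^ n := by
    intro n
    induction n with
    | zero => simp [surjPoly]
    | succ n ih =>
      rw [surjPoly_succ, derivative_mul]
      simp [ih, pow_succ]
  have h2 : (surjPoly n).natDegree < N + 1 := by
    refine Nat.lt_succ_of_le (natDegree_le_iff_coeff_eq_zero.2 fun m hm => ?_)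
    rw [coeff_surjPoly, surjNum_eq_zero (by omega), Nat.cast_zero]
  have h3 := h1 n
  rw [eval_eq_sum_range' h2] at h3
  simp only [coeff_surjPoly] at h3
  have h4 : ∑ m ∈ Finset.range (N + 1), (surjNum n m : ℤ) * (-1) ^ m = (-1) ^ n := by
    exact_mod_cast h3
  rw [pow_succ, ← h4, Finset.sum_mul]
  exact Finset.sum_congr rfl fun m _ => by ring

/-! ### Asymptotics of the h-polynomial and of its smallest zero -/

namespace Complex

variable {α : Type} (Δ : Complex α)

theorem eulerChar_subdivision (h : ∅ ∈ Δ.faces) : Δ.subdivision.eulerChar = Δ.eulerChar := by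
  rw [Δ.subdivision.eulerChar_eq (Δ.maxCard_subdivision h).le, Δ.eulerChar_eq le_rfl]
  simp only [Δ.faceCount_subdivision h le_rfl, Nat.cast_sum, Nat.cast_mul, Finset.mul_sum]
  rw [Finset.sum_comm]
  refine Finset.sum_congr rfl fun n hn => ?_
  rw [← sum_neg_one_pow_mul_surjNum (Finset.mem_range_succ_iff.1 hn), Finset.sum_mul]
  exact Finset.sum_congr rfl fun m _ => by ring

theorem eulerChar_iterSubdivision (h : ∅ ∈ Δ.faces) (k : ℕ) :
    (Δ.iterSubdivision k).eulerChar = Δ.eulerChar := by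
  induction k with
  | zero => rfl
  | succ k ih =>
    exact ((Δ.iterSubdivision k).eulerChar_subdivision (Δ.empty_mem_iterSubdivision h k)).trans ih

theorem coeff_hPoly (j : ℕ) : Δ.hPoly.coeff j = ∑ m ∈ Finset.range (Δ.maxCard + 1),
    (Δ.faceCount m : ℤ) * ((X - 1 : ℤ[X]) ^ (Δ.maxCard - m)).coeff j := by
  rw [hPoly_eq, finsetSum_coeff]
  exact Finset.sum_congr rfl fun m _ => coeff_C_mul _

theorem natDegree_hPoly_le : Δ.hPoly.natDegree ≤ Δ.maxCard := by
  rw [hPoly_eq]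
  refine natDegree_sum_le_of_forall_le _ _ fun m _ => (natDegree_C_mul_le _ _).trans ?_
  refine natDegree_pow_le.trans ?_
  rw [← C_1, natDegree_X_sub_C]
  omega

theorem abs_coeff_zero_hPoly : |Δ.hPoly.coeff 0| = |Δ.eulerChar| := by
  have h : Δ.hPoly.coeff 0 = (-1) ^ (Δ.maxCard + 1) * Δ.eulerChar := by
    rw [coeff_hPoly, Δ.eulerChar_eq le_rfl, Finset.mul_sum]
    refine Finset.sum_congr rfl fun m hm => ?_
    obtain ⟨e, he⟩ := Nat.exists_eq_add_of_le (Finset.mem_range_succ_iff.1 hm)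
    rw [he, Nat.add_sub_cancel_left, coeff_zero_eq_eval_zero, ← mul_assoc, ← pow_add,
      show m + e + 1 + (m + 1) = e + 2 * (m + 1) by ring, pow_add _ e, pow_mul]
    simp [mul_comm]
  rw [h, abs_mul, abs_pow, abs_neg, abs_one, one_pow, one_mul]

/-- By triangularity, the normalized count in size m obeys an affine recursion with ratio m!/(d+1)!
< 1, driven by larger sizes. The eigenvector equation identifies its fixed point. -/
theorem tendsto_faceCount {d : ℕ} (h : ∅ ∈ Δ.faces) (hd : 1 ≤ d) (hN : Δ.maxCard = d + 1)
    (m : ℕ) (hm : m ≤ d + 1) :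
    Tendsto (fun k => ((Δ.iterSubdivision k).faceCount m : ℝ) / ((d + 1).factorial : ℝ) ^ k) atTop
      (𝓝 (Δ.faceCount (d + 1) * ((limitPoly d).coeff m : ℝ))) := by
  have hD : ((d + 1).factorial : ℝ) ≠ 0 := by positivity
  have hrec : ∀ k m, m ≤ d + 1 →
      ((Δ.iterSubdivision (k + 1)).faceCount m : ℝ) / ((d + 1).factorial : ℝ) ^ (k + 1) =
      ((m.factorial : ℝ) / (d + 1).factorial) *
        (((Δ.iterSubdivision k).faceCount m : ℝ) / ((d + 1).factorial : ℝ) ^ k) +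
      ∑ n ∈ (Finset.range (d + 2)).erase m, ((surjNum n m : ℝ) / (d + 1).factorial) *
        (((Δ.iterSubdivision k).faceCount n : ℝ) / ((d + 1).factorial : ℝ) ^ k) := by
    intro k m hm
    rw [Δ.faceCount_iterSubdivision_succ h, hN, ← surjNum_self m,
      Finset.add_sum_erase _ (fun n => ((surjNum n m : ℝ) / (d + 1).factorial) *
        (((Δ.iterSubdivision k).faceCount n : ℝ) / ((d + 1).factorial : ℝ) ^ k))
        (Finset.mem_range.2 (by omega))]
    push_cast
    rw [Finset.sum_div]
    refine Finset.sum_congr rfl fun n _ => ?_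
    rw [pow_succ]
    field_simp
  obtain ⟨e, he⟩ := Nat.exists_eq_add_of_le hm
  -- Descend from the top size, where the normalized count is constant; e is the distance from it.
  induction e using Nat.strong_induction_on generalizing m with
  | _ e ih =>
    rcases hm.eq_or_lt with rfl | hlt
    · have hconst : ∀ k, ((Δ.iterSubdivision k).faceCount (d + 1) : ℝ) /
          ((d + 1).factorial : ℝ) ^ k = Δ.faceCount (d + 1) := by
        intro k
        induction k with
        | zero => rw [pow_zero, div_one]; rfl
        | succ k ihk =>
          rw [hrec k _ le_rfl, ihk, div_self hD, one_mul, Finset.sum_eq_zero, add_zero]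
          intro n hn
          rw [Finset.mem_erase, Finset.mem_range] at hn
          rw [surjNum_eq_zero (by omega)]; simp
      simp only [hconst]
      rw [coeff_limitPoly_succ, if_pos (by omega), FNum_self, Rat.cast_one, mul_one]
      exact tendsto_const_nhds
    · have hfac : (m.factorial : ℝ) < (d + 1).factorial := by
        exact_mod_cast factorial_lt_factorial (by omega) hlt
      refine tendsto_of_affine_recursion (by positivity)
        ((div_lt_one (by positivity)).2 hfac) (fun k => hrec k m hm) ?_
      have heig : ∑ n ∈ Finset.range (d + 2), (surjNum n m : ℝ) * ((limitPoly d).coeff n : ℝ) =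
          (d + 1).factorial * ((limitPoly d).coeff m : ℝ) := by
        exact_mod_cast congrArg (Rat.cast : ℚ → ℝ) (sum_surjNum_mul_coeff_limitPoly hm)
      have hlim : (1 - (m.factorial : ℝ) / (d + 1).factorial) *
          (Δ.faceCount (d + 1) * ((limitPoly d).coeff m : ℝ)) =
          ∑ n ∈ (Finset.range (d + 2)).erase m, ((surjNum n m : ℝ) / (d + 1).factorial) *
            (Δ.faceCount (d + 1) * ((limitPoly d).coeff n : ℝ)) := by
        rw [← Finset.add_sum_erase _ _ (Finset.mem_range.2 (by omega : m < d + 2)),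
          surjNum_self] at heig
        have h1 : ∑ n ∈ (Finset.range (d + 2)).erase m, ((surjNum n m : ℝ) / (d + 1).factorial) *
            (Δ.faceCount (d + 1) * ((limitPoly d).coeff n : ℝ)) =
            (Δ.faceCount (d + 1) / (d + 1).factorial) *
            ∑ n ∈ (Finset.range (d + 2)).erase m,
              (surjNum n m : ℝ) * ((limitPoly d).coeff n : ℝ) := by
          rw [Finset.mul_sum]
          exact Finset.sum_congr rfl fun n _ => by ring
        rw [h1, eq_sub_of_add_eq' heig]
        field_simp
      rw [hlim]
      refine tendsto_finsetSum _ fun n hn => ?_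
      rw [Finset.mem_erase, Finset.mem_range] at hn
      rcases hn.1.lt_or_gt with hnm | hnm
      · rw [surjNum_eq_zero hnm]; simp
      · exact (ih (d + 1 - n) (by omega) n (by omega) (by omega)).const_mul _

theorem tendsto_coeff_hPoly {d : ℕ} (h : ∅ ∈ Δ.faces) (hd : 1 ≤ d) (hN : Δ.maxCard = d + 1)
    (j : ℕ) :
    Tendsto (fun k => ((Δ.iterSubdivision k).hPoly.coeff j : ℝ) / ((d + 1).factorial : ℝ) ^ k)
      atTop (𝓝 (Δ.faceCount (d + 1) * ∑ m ∈ Finset.range (d + 2),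
        ((limitPoly d).coeff m : ℝ) * (((X - 1 : ℤ[X]) ^ (d + 1 - m)).coeff j : ℝ))) := by
  simp only [coeff_hPoly, Δ.maxCard_iterSubdivision h, hN, Int.cast_sum, Int.cast_mul,
    Int.cast_natCast, Finset.sum_div, Finset.mul_sum]
  refine tendsto_finsetSum _ fun m hm => ?_
  simp only [mul_div_right_comm, ← mul_assoc]
  exact (Δ.tendsto_faceCount h hd hN m (Finset.mem_range_succ_iff.1 hm)).mul_const _

theorem tendsto_coeff_one_hPoly {d : ℕ} (h : ∅ ∈ Δ.faces) (hd : 1 ≤ d)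
    (hN : Δ.maxCard = d + 1) :
    Tendsto (fun k => ((Δ.iterSubdivision k).hPoly.coeff 1 : ℝ) / ((d + 1).factorial : ℝ) ^ k)
      atTop (𝓝 (HNum 1 d * Δ.faceCount (d + 1))) := by
  have h1 := Δ.tendsto_coeff_hPoly h hd hN 1
  have h2 : ∑ m ∈ Finset.range (d + 2),
      ((limitPoly d).coeff m : ℝ) * (((X - 1 : ℤ[X]) ^ (d + 1 - m)).coeff 1 : ℝ) = HNum 1 d := by
    rw [HNum_one, ← sum_coeff_limitPoly_mul hd, Rat.cast_sum]
    refine Finset.sum_congr rfl fun m _ => ?_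
    rw [coeff_one_X_sub_one_pow, coeff_one_X_sub_one_pow]
    push_cast; rfl
  rwa [h2, mul_comm] at h1

theorem norm_mul_abs_coeff_one_le {z : ℂ} (hχ : Δ.eulerChar ≠ 0)
    (hz : IsMinModulusZero Δ.hPoly z) :
    ‖z‖ * |(Δ.hPoly.coeff 1 : ℝ)| ≤ Δ.maxCard * |(Δ.eulerChar : ℝ)| := by
  have h0 : (Δ.hPoly.map (Int.castRingHom ℂ)).eval 0 = (Δ.hPoly.coeff 0 : ℂ) := by
    rw [← coeff_zero_eq_eval_zero, coeff_map, eq_intCast]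
  have h1 : (derivative (Δ.hPoly.map (Int.castRingHom ℂ))).eval 0 = (Δ.hPoly.coeff 1 : ℂ) := by
    rw [← coeff_zero_eq_eval_zero, coeff_derivative, coeff_map, eq_intCast]; simp
  have hc := Δ.abs_coeff_zero_hPoly
  have hc' : |(Δ.hPoly.coeff 0 : ℝ)| = |(Δ.eulerChar : ℝ)| := by exact_mod_cast hc
  have h2 := norm_mul_norm_eval_derivative_le (p := Δ.hPoly.map (Int.castRingHom ℂ)) (z := z)
    (by
      rw [h0, Int.cast_ne_zero, ← abs_ne_zero, hc, abs_ne_zero]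
      exact hχ)
    (fun w hw => hz.2 w (by rwa [aeval_def, algebraMap_int_eq, ← eval_map]))
  rw [h0, h1, Complex.norm_intCast, Complex.norm_intCast, hc'] at h2
  refine h2.trans ?_
  have : (Δ.hPoly.map (Int.castRingHom ℂ)).natDegree ≤ Δ.maxCard :=
    natDegree_map_le.trans Δ.natDegree_hPoly_le
  gcongr

theorem abs_eulerChar_eq_norm_mul {z : ℂ} {d : ℕ} (hN : Δ.maxCard = d + 1)
    (hz : aeval z Δ.hPoly = 0) :
    |(Δ.eulerChar : ℝ)| =
      ‖z‖ * ‖∑ j ∈ Finset.range (d + 1), (Δ.hPoly.coeff (j + 1) : ℂ) * z ^ j‖ := by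
  rw [aeval_eq_sum_range' (Nat.lt_succ_of_le Δ.natDegree_hPoly_le), hN,
    Finset.sum_range_succ'] at hz
  have h1 : (Δ.hPoly.coeff 0 : ℂ) =
      -(z * ∑ j ∈ Finset.range (d + 1), (Δ.hPoly.coeff (j + 1) : ℂ) * z ^ j) := by
    rw [eq_neg_iff_add_eq_zero, ← hz, Finset.mul_sum, add_comm]
    congr 1
    · exact Finset.sum_congr rfl fun j _ => by rw [zsmul_eq_mul]; ring
    · simp
  have h2 : |(Δ.hPoly.coeff 0 : ℝ)| = |(Δ.eulerChar : ℝ)| := by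
    exact_mod_cast Δ.abs_coeff_zero_hPoly
  rw [← h2, ← Complex.norm_intCast, h1, norm_neg, norm_mul]

theorem tendsto_abs_eulerChar_div {d : ℕ} (h : ∅ ∈ Δ.faces) (hd : 1 ≤ d)
    (hN : Δ.maxCard = d + 1) {ρ : ℕ → ℂ}
    (hρ : ∀ k, IsMinModulusZero (Δ.iterSubdivision k).hPoly (ρ k)) (hχ : Δ.eulerChar ≠ 0) :
    Tendsto (fun k => |(Δ.eulerChar : ℝ)| / (HNum 1 d * Δ.faceCount (d + 1) * ‖ρ k‖ *
      ((d + 1).factorial : ℝ) ^ k)) atTop (𝓝 1) := by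
  set D : ℝ := ((d + 1).factorial : ℝ) with hDdef
  have hD1 : 1 < D := by
    rw [hDdef, Nat.one_lt_cast]
    exact factorial_lt_factorial (m := 0) (by omega) (by omega)
  have hD0 : 0 < D := one_pos.trans hD1
  set A : ℝ := HNum 1 d * Δ.faceCount (d + 1) with hA
  have hApos : 0 < A := by
    have h1 : (0 : ℝ) < HNum 1 d := by
      rw [HNum_one]; exact_mod_cast FNum_zero_pos d
    have h2 : (0 : ℝ) < Δ.faceCount (d + 1) := by
      rw [← hN]; exact_mod_cast Δ.faceCount_maxCard_pos h
    positivity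
  have hone := Δ.tendsto_coeff_one_hPoly h hd hN
  rw [← hDdef, ← hA] at hone
  have hρ0 : Tendsto ρ atTop (𝓝 0) := by
    rw [tendsto_zero_iff_norm_tendsto_zero]
    have hprod : Tendsto (fun k => ‖ρ k‖ * |((Δ.iterSubdivision k).hPoly.coeff 1 : ℝ) / D ^ k|)
        atTop (𝓝 0) := by
      have hz : Tendsto (fun k => (d + 1 : ℕ) * |(Δ.eulerChar : ℝ)| * (D⁻¹) ^ k) atTop (𝓝 0) := by
        simpa using (tendsto_pow_atTop_nhds_zero_of_lt_one (by positivity)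
          (inv_lt_one_of_one_lt₀ hD1)).const_mul ((d + 1 : ℕ) * |(Δ.eulerChar : ℝ)|)
      refine squeeze_zero (fun k => by positivity) (fun k => ?_) hz
      have h1 := (Δ.iterSubdivision k).norm_mul_abs_coeff_one_le
        (by rwa [Δ.eulerChar_iterSubdivision h k]) (hρ k)
      rw [Δ.eulerChar_iterSubdivision h k, Δ.maxCard_iterSubdivision h, hN] at h1
      rw [abs_div, abs_of_pos (pow_pos hD0 k), ← mul_div_assoc, inv_pow, ← div_eq_mul_inv]
      gcongr
    -- The normalized linear coefficient has the nonzero limit A, so dividing by it leaves ‖ρ k‖ →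
    -- 0.
    have hdiv := hprod.div hone.abs (abs_ne_zero.2 hApos.ne')
    rw [zero_div] at hdiv
    refine hdiv.congr' ?_
    filter_upwards [hone.eventually_ne hApos.ne'] with k hk
    exact mul_div_cancel_right₀ _ (abs_ne_zero.2 hk)
  have hq : Tendsto (fun k => ∑ j ∈ Finset.range (d + 1),
      ((((Δ.iterSubdivision k).hPoly.coeff (j + 1) : ℝ) / D ^ k : ℝ) : ℂ) * ρ k ^ j) atTop
      (𝓝 (A : ℂ)) := by
    simp only [Finset.sum_range_succ']
    have h0 : Tendsto (fun k => ((((Δ.iterSubdivision k).hPoly.coeff (0 + 1) : ℝ) / D ^ k : ℝ) : ℂ)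
        * ρ k ^ 0) atTop (𝓝 (A : ℂ)) := by
      simp only [pow_zero, mul_one, zero_add]
      exact (Complex.continuous_ofReal.tendsto _).comp hone
    -- Higher coefficients are also of order at most D^k, and each carries a positive power of ρ k.
    have hs : Tendsto (fun k => ∑ j ∈ Finset.range d,
        ((((Δ.iterSubdivision k).hPoly.coeff (j + 1 + 1) : ℝ) / D ^ k : ℝ) : ℂ) * ρ k ^ (j + 1))
        atTop (𝓝 0) := by
      rw [← Finset.sum_const_zero (s := Finset.range d)]
      refine tendsto_finsetSum _ fun j _ => ?_
      have := ((Complex.continuous_ofReal.tendsto _).comp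
        (Δ.tendsto_coeff_hPoly h hd hN (j + 1 + 1))).mul (hρ0.pow (j + 1))
      rw [zero_pow j.succ_ne_zero, mul_zero] at this
      exact this
    simpa using hs.add h0
  have hfin := (hq.norm).div_const A
  rw [Complex.norm_real, Real.norm_of_nonneg hApos.le, div_self hApos.ne'] at hfin
  refine hfin.congr fun k => ?_
  have h1 := (Δ.iterSubdivision k).abs_eulerChar_eq_norm_mul
    ((Δ.maxCard_iterSubdivision h k).trans hN) (hρ k).1
  rw [Δ.eulerChar_iterSubdivision h k] at h1
  have hρk : ‖ρ k‖ ≠ 0 := by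
    intro h0
    rw [h0, zero_mul, abs_eq_zero, Int.cast_eq_zero] at h1
    exact hχ h1
  have h2 : ∑ j ∈ Finset.range (d + 1),
      ((((Δ.iterSubdivision k).hPoly.coeff (j + 1) : ℝ) / D ^ k : ℝ) : ℂ) * ρ k ^ j =
      (∑ j ∈ Finset.range (d + 1), ((Δ.iterSubdivision k).hPoly.coeff (j + 1) : ℂ) * ρ k ^ j) /
        ((D ^ k : ℝ) : ℂ) := by
    rw [Finset.sum_div]
    refine Finset.sum_congr rfl fun j _ => ?_
    push_cast; ring
  rw [h2, norm_div, Complex.norm_real, Real.norm_of_nonneg (pow_pos hD0 k).le, h1]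
  have := (pow_pos hD0 k).ne'
  have := hApos.ne'
  field_simp

theorem eq_zero_of_isMinModulusZero {z : ℂ} (hχ : Δ.eulerChar = 0)
    (hz : IsMinModulusZero Δ.hPoly z) : z = 0 := by
  have h0 : Δ.hPoly.coeff 0 = 0 := by
    rw [← abs_eq_zero, Δ.abs_coeff_zero_hPoly, hχ, abs_zero]
  have h := hz.2 0 (by rw [aeval_def, eval₂_at_zero, h0, map_zero])
  rwa [norm_zero, norm_le_zero_iff] at h

end Complex

/-! ### The complex of squarefree integers -/

theorem empty_mem_primeComplex {n : ℕ} (hn : 1 ≤ n) : ∅ ∈ (primeComplex n).faces :=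
  Finset.mem_image.2 ⟨1, by simp [hn], by simp⟩

/-- The integer 6 = 2 · 3 supplies an edge, which ensures d ≥ 1 and hence that (d+1)! is a strictly
dominant eigenvalue. -/
theorem two_le_maxCard_primeComplex {n : ℕ} (hn : 6 ≤ n) : 2 ≤ (primeComplex n).maxCard := by
  have hsq : Squarefree 6 := by
    rw [show 6 = 2 * 3 from rfl, Nat.squarefree_mul (by norm_num)]
    exact ⟨Nat.prime_two.prime.squarefree, Nat.prime_three.prime.squarefree⟩
  have hmem : Nat.primeFactors 6 ∈ (primeComplex n).faces :=
    Finset.mem_image.2 ⟨6, by simp [hn, hsq], rfl⟩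
  have hcard : (Nat.primeFactors 6).card = 2 := by
    rw [show 6 = 2 * 3 from rfl, Nat.primeFactors_mul (by norm_num) (by norm_num),
      Nat.prime_two.primeFactors, Nat.prime_three.primeFactors]
    rfl
  rw [← hcard]
  exact Finset.le_sup hmem

end BarySub

theorem mainTheorem9 (n : ℕ) (hn : 6 ≤ n) :
    ∃ d : ℕ, (BarySub.primeComplex n).dim = d ∧
      ∀ ρ₀ : ℕ → ℂ,
        (∀ k : ℕ, BarySub.IsMinModulusZero
          ((BarySub.primeComplex n).iterSubdivision k).hPoly (ρ₀ k)) →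
        ((BarySub.primeComplex n).eulerChar ≠ 0 →
          Filter.Tendsto
            (fun k : ℕ => |((BarySub.primeComplex n).eulerChar : ℝ)| /
              ((BarySub.HNum 1 d : ℝ) * ((BarySub.primeComplex n).numFaces d : ℝ) * ‖ρ₀ k‖ *
                ((d + 1).factorial : ℝ) ^ k))
            Filter.atTop (nhds 1)) ∧
        ((BarySub.primeComplex n).eulerChar = 0 →
          ∀ k : ℕ, (BarySub.HNum 1 d : ℝ) * ((BarySub.primeComplex n).numFaces d : ℝ) * ‖ρ₀ k‖ *
                ((d + 1).factorial : ℝ) ^ k = 0) := by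
  have hempty := BarySub.empty_mem_primeComplex (by omega : 1 ≤ n)
  have h2 := BarySub.two_le_maxCard_primeComplex hn
  obtain ⟨d, hd⟩ := Nat.exists_eq_add_of_le' (by omega : 1 ≤ (BarySub.primeComplex n).maxCard)
  refine ⟨d, by rw [BarySub.Complex.dim_eq, hd]; simp, fun ρ hρ => ⟨fun hχ => ?_, fun hχ k => ?_⟩⟩
  · have hface : (BarySub.primeComplex n).numFaces d =
        (BarySub.primeComplex n).faceCount (d + 1) := by
      rw [← BarySub.Complex.numFaces_natCast_sub_one]; simp
    rw [hface]
    exact (BarySub.primeComplex n).tendsto_abs_eulerChar_div hempty (by omega) hd hρ hχ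
  · have h0 := ((BarySub.primeComplex n).iterSubdivision k).eq_zero_of_isMinModulusZero
      (by rw [BarySub.Complex.eulerChar_iterSubdivision _ hempty, hχ]) (hρ k)
    rw [h0, norm_zero, mul_zero, zero_mul]
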